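/- Let $J\subseteq\mathbb R$ be an interval. For a function $f:J\to[0,\infty)$ that is convex, let $C_{\exp}(f)=\{r\in\mathbb R : r\ge 1 \text{ and } x\mapsto f(x)^{1/r}\text{ is convex on }J\}$ be its set of convex exponents, and let its index of convexity be $I_{conv}(f)=\sup C_{\exp}(f)\in[1,\infty]$. A function $f:J\to(0,\infty)$ is log-convex if $\log f$ is convex on $J$. A norm $\|\cdot\|$ on the space $\mathcal M_n$ of complex $n\times n$ matrices is unitarily invariant if $\|UXV\|=\|X\|$ for every $X\in\mathcal M_n$ and all unitary $U,V\in\mathcal M_n$. (i) If $f:J\to(0,\infty)$ is log-convex on an interval $J$, then $f$ is convex and $I_{conv}(f)=\infty$. (ii) Let $A,B\in\mathcal M_n$ be positive definite, let $X\in\mathcal M_n$, and let $\|\cdot\|$ be a unitarily invariant norm on $\mathcal M_n$. Then the function $f:\mathbb R\to[0,\infty)$, $f(t)=\|A^{t}XB^{1-t}\|$, is convex and $I_{conv}(f)=\infty$. -/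

import Mathlib

open scoped MatrixOrder ComplexOrder

/-- `f` is log-convex on the interval `J`: it is positive there and `log f` is convex there.
(`ConvexOn ℝ J _` includes that `J` is convex, i.e. an interval, possibly unbounded.) -/
structure LogConvexOn (J : Set ℝ) (f : ℝ → ℝ) : Prop where
  pos : ∀ x ∈ J, 0 < f x
  convexOn_log : ConvexOn ℝ J (fun x => Real.log (f x))

/-- The set of convex exponents of a nonnegative function `f` on `J`: all real `r ≥ 1` such that
`f ^ (1 / r)` is convex on `J`. -/
def convexExponents (J : Set ℝ) (f : ℝ → ℝ) : Set ℝ :=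
  {r : ℝ | 1 ≤ r ∧ ConvexOn ℝ J (fun x => f x ^ (1 / r))}

/-- The index of convexity of `f` on `J`: the supremum, in the extended reals, of the set of
convex exponents. -/
noncomputable def indexOfConvexity (J : Set ℝ) (f : ℝ → ℝ) : EReal :=
  sSup ((fun r : ℝ => (r : EReal)) '' convexExponents J f)

/-- A unitarily invariant norm on the complex `n × n` matrices: a seminorm `N` which is definite
and satisfies `N (U * X * V) = N X` for all unitary `U`, `V`. -/
structure IsUnitarilyInvariantNorm {n : ℕ} (N : Seminorm ℂ (Matrix (Fin n) (Fin n) ℂ)) :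
    Prop where
  eq_zero_of_map_eq_zero : ∀ X, N X = 0 → X = 0
  map_unitary_mul_mul : ∀ U ∈ Matrix.unitaryGroup (Fin n) ℂ,
    ∀ V ∈ Matrix.unitaryGroup (Fin n) ℂ, ∀ X, N (U * X * V) = N X

/-! For p ≥ 0, f^p = exp(p log f) is an increasing convex function of a convex one, so every r ≥ 1
is a convex exponent. For matrices with X ≠ 0, log-convexity is Hadamard's three-lines theorem for z
↦ A^z X B^(1-z). In eigenbases of A and B this is a finite exponential sum, hence entire; Im z
contributes only unitary factors, so the norm depends on Re z alone
(`diagonal_exp_mul_mul_diagonal_exp_re`). -/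

theorem LogConvexOn.convexOn_rpow {J : Set ℝ} {f : ℝ → ℝ} (hf : LogConvexOn J f) {p : ℝ}
    (hp : 0 ≤ p) : ConvexOn ℝ J (fun x => f x ^ p) := by
  have hlog := hf.convexOn_log
  refine ⟨hlog.1, fun x hx y hy a b ha hb hab => ?_⟩
  simp only [Real.rpow_def_of_pos (hf.pos _ hx), Real.rpow_def_of_pos (hf.pos _ hy),
    Real.rpow_def_of_pos (hf.pos _ (hlog.1 hx hy ha hb hab))]
  refine le_trans (Real.exp_le_exp.2 ?_)
    (convexOn_exp.2 (Set.mem_univ _) (Set.mem_univ _) ha hb hab)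
  have := mul_le_mul_of_nonneg_right (hlog.2 hx hy ha hb hab) hp
  simp only [smul_eq_mul] at this ⊢
  linarith

theorem LogConvexOn.convexOn {J : Set ℝ} {f : ℝ → ℝ} (hf : LogConvexOn J f) : ConvexOn ℝ J f := by
  simpa using hf.convexOn_rpow zero_le_one

theorem indexOfConvexity_eq_top {J : Set ℝ} {f : ℝ → ℝ}
    (h : ∀ r : ℝ, 1 ≤ r → ConvexOn ℝ J (fun x => f x ^ (1 / r))) : indexOfConvexity J f = ⊤ := by
  refine EReal.eq_top_iff_forall_lt _ |>.2 fun y => ?_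
  refine lt_of_lt_of_le (EReal.coe_lt_coe_iff.2 ((lt_add_one y).trans_le (le_max_right 1 _)))
    (le_sSup ⟨max 1 (y + 1), ⟨le_max_left _ _, h _ (le_max_left _ _)⟩, rfl⟩)

theorem LogConvexOn.indexOfConvexity_eq_top {J : Set ℝ} {f : ℝ → ℝ} (hf : LogConvexOn J f) :
    indexOfConvexity J f = ⊤ :=
  _root_.indexOfConvexity_eq_top fun _ hr => hf.convexOn_rpow (by positivity)

/-- A positive function with the multiplicative three-lines inequality is log-convex. -/
theorem LogConvexOn.of_rpow_mul_rpow {f : ℝ → ℝ} (hpos : ∀ x, 0 < f x)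
    (h : ∀ l u x, l < u → x ∈ Set.Icc l u →
      f x ≤ f l ^ (1 - (x - l) / (u - l)) * f u ^ ((x - l) / (u - l))) :
    LogConvexOn Set.univ f where
  pos x _ := hpos x
  convexOn_log := by
    refine LinearOrder.convexOn_of_lt convex_univ fun x _ y _ hxy a b ha hb hab => ?_
    have hx : a • x + b • y ∈ Set.Icc x y := by
      obtain rfl : a = 1 - b := by linarith
      simp only [smul_eq_mul, Set.mem_Icc]
      constructor <;> nlinarith
    have hb' : (a • x + b • y - x) / (y - x) = b := by
      obtain rfl : a = 1 - b := by linarith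
      have : y - x ≠ 0 := by linarith
      simp only [smul_eq_mul]
      field_simp
      ring
    have key := Real.log_le_log (hpos _) (h x y _ hxy hx)
    rw [hb', Real.log_mul (Real.rpow_pos_of_pos (hpos _) _).ne'
      (Real.rpow_pos_of_pos (hpos _) _).ne', Real.log_rpow (hpos _), Real.log_rpow (hpos _),
      show 1 - b = a by linarith] at key
    exact key

open Complex Complex.HadamardThreeLines in
/-- Three-lines theorem for an exponential sum with values in a space with a definite seminorm
which, along vertical lines, has constant seminorm. -/
theorem Seminorm.sum_exp_smul_le_interp {V ι : Type*} [AddCommGroup V] [Module ℂ V]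
    (N : Seminorm ℂ V) (hN : ∀ v, N v = 0 → v = 0) (s : Finset ι) (c : ι → ℂ) (v : ι → V)
    (hre : ∀ z : ℂ, N (∑ i ∈ s, exp (c i * z) • v i) = N (∑ i ∈ s, exp (c i * z.re) • v i))
    {l u x : ℝ} (hlu : l < u) (hx : x ∈ Set.Icc l u) :
    N (∑ i ∈ s, exp (c i * x) • v i) ≤
      N (∑ i ∈ s, exp (c i * l) • v i) ^ (1 - (x - l) / (u - l)) *
        N (∑ i ∈ s, exp (c i * u) • v i) ^ ((x - l) / (u - l)) := by
  let _ : NormedAddCommGroup V := AddGroupNorm.toNormedAddCommGroup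
    { N.toAddGroupSeminorm with eq_zero_of_map_eq_zero' := hN }
  let _ : NormedSpace ℂ V := { norm_smul_le := fun a b => (map_smul_eq_mul N a b).le }
  have hd : Differentiable ℂ fun z : ℂ => ∑ i ∈ s, exp (c i * z) • v i := by fun_prop
  have hnorm : ∀ w : V, ‖w‖ = N w := fun _ => rfl
  -- By `hre`, boundedness on the strip reduces to the compact segment [l, u].
  have hB : BddAbove ((norm ∘ fun z : ℂ => ∑ i ∈ s, exp (c i * z) • v i) ''
      verticalClosedStrip l u) := by
    have hc : Continuous fun y : ℝ => ‖∑ i ∈ s, exp (c i * y) • v i‖ :=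
      (hd.continuous.comp continuous_ofReal).norm
    obtain ⟨C, hC⟩ := isCompact_Icc.bddAbove_image (hc.continuousOn (s := Set.Icc l u))
    refine ⟨C, ?_⟩
    rintro _ ⟨z, hz, rfl⟩
    refine le_of_eq_of_le (hre z) (hC ⟨z.re, hz, rfl⟩)
  have key := norm_le_interp_of_mem_verticalClosedStrip' (z := (x : ℂ))
    (a := N (∑ i ∈ s, exp (c i * l) • v i)) (b := N (∑ i ∈ s, exp (c i * u) • v i))
    hlu (by simpa [verticalClosedStrip] using hx) hd.diffContOnCl hB
    (fun z hz => by
      obtain rfl : z.re = l := hz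
      exact (hre z).le)
    (fun z hz => by
      obtain rfl : z.re = u := hz
      exact (hre z).le)
  simpa [hnorm] using key

namespace Matrix

variable {n : ℕ}

/-- Real powers of a positive definite matrix in terms of an orthonormal eigenbasis. -/
theorem PosDef.exists_rpow_eq {A : Matrix (Fin n) (Fin n) ℂ} (hA : A.PosDef) :
    ∃ U ∈ unitaryGroup (Fin n) ℂ, ∃ a : Fin n → ℝ, ∀ t : ℝ,
      A ^ t = U * diagonal (fun i => Complex.exp (a i * t)) * star U := by
  refine ⟨hA.isHermitian.eigenvectorUnitary, hA.isHermitian.eigenvectorUnitary.2,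
    fun i => Real.log (hA.isHermitian.eigenvalues i), fun t => ?_⟩
  rw [CFC.rpow_eq_cfc_real (nonneg_iff_posSemidef.2 hA.posSemidef), hA.isHermitian.cfc_eq,
    IsHermitian.cfc, Unitary.conjStarAlgAut_apply]
  congr 3
  funext i
  simp [Real.rpow_def_of_pos (hA.eigenvalues_pos i)]

theorem PosDef.isUnit_rpow {A : Matrix (Fin n) (Fin n) ℂ} (hA : A.PosDef) (t : ℝ) :
    IsUnit (A ^ t) :=
  hA.isUnit.cfcRpow t (nonneg_iff_posSemidef.2 hA.posSemidef)

/-- The matrix `diag (exp (a i * z)) * Y * diag (exp (b j * (1 - z)))` is an exponential sum. -/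
theorem diagonal_exp_mul_mul_diagonal_exp (a b : Fin n → ℝ) (Y : Matrix (Fin n) (Fin n) ℂ)
    (z : ℂ) :
    diagonal (fun i => Complex.exp (a i * z)) * Y * diagonal (fun j => Complex.exp (b j * (1 - z)))
      = ∑ p : Fin n × Fin n, Complex.exp (((a p.1 - b p.2 : ℝ) : ℂ) * z) •
          single p.1 p.2 (Complex.exp (b p.2) * Y p.1 p.2) := by
  rw [Fintype.sum_prod_type]
  conv_lhs => rw [matrix_eq_sum_single (diagonal _ * Y * diagonal _)]
  refine Finset.sum_congr rfl fun i _ => Finset.sum_congr rfl fun j _ => ?_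
  rw [smul_single, mul_diagonal, diagonal_mul, smul_eq_mul, ← mul_assoc, ← Complex.exp_add,
    mul_right_comm, ← Complex.exp_add]
  congr 3
  push_cast
  ring

theorem diagonal_exp_mul_I_mem_unitaryGroup (a : Fin n → ℝ) :
    diagonal (fun i => Complex.exp (a i * Complex.I)) ∈ unitaryGroup (Fin n) ℂ := by
  rw [mem_unitaryGroup_iff, star_eq_conjTranspose, diagonal_conjTranspose, diagonal_mul_diagonal,
    ← diagonal_one]
  congr 1
  funext i
  simp [← Complex.exp_conj, ← Complex.exp_add]

end Matrix

open Matrix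

/-- Passing from Re z to z multiplies by diagonal unitaries, with phases a_i Im z on the left and
-b_j Im z on the right. -/
theorem IsUnitarilyInvariantNorm.diagonal_exp_mul_mul_diagonal_exp_re {n : ℕ}
    {N : Seminorm ℂ (Matrix (Fin n) (Fin n) ℂ)} (hN : IsUnitarilyInvariantNorm N)
    (a b : Fin n → ℝ) (Y : Matrix (Fin n) (Fin n) ℂ) (z : ℂ) :
    N (diagonal (fun i => Complex.exp (a i * z)) * Y *
        diagonal (fun j => Complex.exp (b j * (1 - z)))) =
      N (diagonal (fun i => Complex.exp (a i * z.re)) * Y *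
        diagonal (fun j => Complex.exp (b j * (1 - z.re)))) := by
  rw [← hN.map_unitary_mul_mul _ (diagonal_exp_mul_I_mem_unitaryGroup fun i => a i * z.im)
    _ (diagonal_exp_mul_I_mem_unitaryGroup fun j => -(b j * z.im))
    (diagonal (fun i => Complex.exp (a i * z.re)) * Y * diagonal _)]
  simp only [← mul_assoc, diagonal_mul_diagonal, ← Complex.exp_add]
  simp only [mul_assoc, diagonal_mul_diagonal, ← Complex.exp_add]
  congr 4 <;> funext i
  · congr 1
    conv_lhs => rw [← Complex.re_add_im z]
    push_cast
    ring
  · congr 2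
    conv_lhs => rw [← Complex.re_add_im z]
    push_cast
    ring

theorem IsUnitarilyInvariantNorm.logConvexOn_rpow_mul_mul_rpow {n : ℕ}
    {N : Seminorm ℂ (Matrix (Fin n) (Fin n) ℂ)} (hN : IsUnitarilyInvariantNorm N)
    {A B X : Matrix (Fin n) (Fin n) ℂ} (hA : A.PosDef) (hB : B.PosDef) (hX : X ≠ 0) :
    LogConvexOn Set.univ fun t : ℝ => N (A ^ t * X * B ^ (1 - t)) := by
  refine LogConvexOn.of_rpow_mul_rpow (fun t => ?_) ?_
  -- Powers of A and B are invertible, so the product vanishes only if X does.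
  · refine lt_of_le_of_ne (apply_nonneg N _) fun h => hX ?_
    have h0 := hN.eq_zero_of_map_eq_zero _ h.symm
    have hA' := hA.isUnit_rpow t
    have hB' := hB.isUnit_rpow (1 - t)
    rwa [hB'.mul_left_eq_zero, hA'.mul_right_eq_zero] at h0
  · obtain ⟨U, hU, a, ha⟩ := hA.exists_rpow_eq
    obtain ⟨V, hV, b, hb⟩ := hB.exists_rpow_eq
    -- N absorbs the outer unitaries U and V*, leaving the diagonal form with Y = U* X V.
    have hG : ∀ t : ℝ, N (A ^ t * X * B ^ (1 - t)) =
        N (∑ p : Fin n × Fin n, Complex.exp (((a p.1 - b p.2 : ℝ) : ℂ) * t) •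
          single p.1 p.2 (Complex.exp (b p.2) * (star U * X * V) p.1 p.2)) := fun t => by
      rw [← diagonal_exp_mul_mul_diagonal_exp, ha, hb,
        ← hN.map_unitary_mul_mul U hU (star V) (Unitary.star_mem hV) (diagonal _ * _ * diagonal _)]
      push_cast
      simp only [mul_assoc]
    intro l u x hlu hx
    simp only [hG]
    refine N.sum_exp_smul_le_interp hN.eq_zero_of_map_eq_zero _ _ _ (fun z => ?_) hlu hx
    simp only [← diagonal_exp_mul_mul_diagonal_exp]
    exact hN.diagonal_exp_mul_mul_diagonal_exp_re a b _ z

theorem mainTheorem12 :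
    (∀ (J : Set ℝ) (f : ℝ → ℝ), LogConvexOn J f →
      ConvexOn ℝ J f ∧ indexOfConvexity J f = ⊤) ∧
    (∀ (n : ℕ) (A B X : Matrix (Fin n) (Fin n) ℂ), A.PosDef → B.PosDef →
      ∀ N : Seminorm ℂ (Matrix (Fin n) (Fin n) ℂ), IsUnitarilyInvariantNorm N →
        ConvexOn ℝ Set.univ (fun t : ℝ => N (A ^ t * X * B ^ (1 - t))) ∧
        indexOfConvexity Set.univ (fun t : ℝ => N (A ^ t * X * B ^ (1 - t))) = ⊤) := by
  refine ⟨fun J f hf => ⟨hf.convexOn, hf.indexOfConvexity_eq_top⟩, fun n A B X hA hB N hN => ?_⟩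
  rcases eq_or_ne X 0 with rfl | hX
  -- Here f is identically 0, so not log-convex, but all its powers are constant.
  · simp only [mul_zero, zero_mul, map_zero]
    exact ⟨convexOn_const _ convex_univ,
      indexOfConvexity_eq_top fun _ _ => convexOn_const _ convex_univ⟩
  · have h := hN.logConvexOn_rpow_mul_mul_rpow hA hB hX
    exact ⟨h.convexOn, h.indexOfConvexity_eq_top⟩
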